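/- Let $n,m,k,W\ge 1$ be integers and let $\alpha,\beta\ge 0$ be reals. An integer program (IP) $(\vec c,A,\vec b)$ with $m$ constraints and $n$ variables is $\max\{\vec c^T\vec x : A\vec x\le\vec b,\ \vec x\ge 0,\ \vec x\in\mathbb Z^n\}$ with $A\in\mathbb Z^{m\times n}$, $\vec b\in\mathbb Z^m$, $\vec c\in\mathbb R^n$. Adding the Chvátal–Gomory (CG) cut with parameter $\vec u\in[0,1]^m$ means adding the row $\lfloor \vec u^TA\rfloor\vec x\le\lfloor\vec u^T\vec b\rfloor$ to the constraints. For vectors $\vec u^1_w,\ldots,\vec u^k_w\in[0,1]^{m+k(w-1)}$, $w=1,\ldots,W$, apply $W$ waves of cuts at the root: for $w=1,\ldots,W$ in turn, add to the current IP (which has $m+k(w-1)$ constraints) simultaneously the $k$ CG cuts with parameters $\vec u^1_w,\ldots,\vec u^k_w$, all computed from the current constraints. Let $f_{\vec u^1_1,\ldots,\vec u^k_1,\ldots,\vec u^1_W,\ldots,\vec u^k_W}(\vec c,A,\vec b)$ be the size (number of nodes) of the search tree that branch-and-cut builds on the resulting IP. Here all other aspects of branch-and-cut are fixed: the LP solver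 (which returns an optimal solution of a node's LP relaxation whenever one exists), the node selection policy, the variable selection policy, and a cap $\kappa$ on the tree size. Starting from the root, branch-and-cut repeatedly selects an active leaf and solves its LP relaxation. It fathoms the leaf if the relaxation is infeasible, if the objective value of the LP solution $\vec x^*$ is no better than that of the best integral solution found so far, or if $\vec x^*$ is integral (in which case $\vec x^*$ becomes the best solution found). Otherwise it selects a variable $x[i]$ and adds two children, with the additional constraint $x[i]\le\lfloor x^*[i]\rfloor$ and $x[i]\ge\lceil x^*[i]\rceil$ respectively. It stops when there is no active leaf, when adding the two children would make the number of nodes exceed $\kappa$, or when it meets an unbounded LP relaxation. The pseudo-dimension $\operatorname{Pdim}(\mathcal F)$ of a class $\mathcal F\subseteq\mathbb R^{\mathcal Y}$ is the largest $N$ for which there are $y_1,\ldots,y_N\in\mathcal Y$ and $r_1,\ldots,r_N\in\mathbb R$ such that for every $(\sigma_1,\ldots,\sigma_N)\in\{0,1\}^N$ there is $f\in\mathcal F$ with $f(y_i)\ge r_i$ if and only if $\sigma_i=1$, for all $i$. Let $\mathcal F_{\alpha,\beta}$ be the set of all functions $f_{\vec u^1_1,\ldots,\vec u^k_1,\ldots,\vec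 u^1_W,\ldots,\vec u^k_W}$ with $\vec u^1_1,\ldots,\vec u^k_1\in[0,1]^m,\ \ldots,\ \vec u^1_W,\ldots,\vec u^k_W\in[0,1]^{m+k(W-1)}$, defined on the domain of IPs $(\vec c,A,\vec b)$ with $m$ constraints and $n$ variables satisfying $\|A\|_{1,1}=\sum_{i,j}|A_{ij}|\le\alpha$ and $\|\vec b\|_1\le\beta$. Then $\operatorname{Pdim}(\mathcal F_{\alpha,\beta})$ is finite and $$\operatorname{Pdim}(\mathcal F_{\alpha,\beta})=O\bigl(mk^2W^2\log(mkW(\alpha+\beta+n))\bigr),$$ with an absolute implied constant (independent of $n,m,k,W,\alpha,\beta,\kappa$ and of the fixed solver and policies), and for all $n,m,k,W\ge1$ and $\alpha,\beta\ge0$. -/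

import Mathlib

namespace BranchCut

/-- An integer program in canonical form `max {c ⬝ x : A x ≤ b, x ≥ 0, x ∈ ℤⁿ}` with `m` constraints
and `n` variables; the constraint data are integral, the objective is real. -/
structure IP (m n : ℕ) where
  c : Fin n → ℝ
  A : Matrix (Fin m) (Fin n) ℤ
  b : Fin m → ℤ

/-- `‖A‖_{1,1}`, the sum of the absolute values of all entries of the constraint matrix. -/
def IP.normA {m n : ℕ} (I : IP m n) : ℝ := ∑ i, ∑ j, |(I.A i j : ℝ)|

/-- `‖b‖₁`. -/
def IP.normb {m n : ℕ} (I : IP m n) : ℝ := ∑ i, |(I.b i : ℝ)|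

/-! ### Chvátal–Gomory cuts, added in waves -/

/-- The left-hand side `⌊uᵀA⌋` of the Chvátal–Gomory cut with parameter `u`. -/
noncomputable def IP.cgRow {m n : ℕ} (I : IP m n) (u : Fin m → ℝ) : Fin n → ℤ :=
  fun j => ⌊∑ i, u i * (I.A i j : ℝ)⌋

/-- The right-hand side `⌊uᵀb⌋` of the Chvátal–Gomory cut with parameter `u`. -/
noncomputable def IP.cgRhs {m n : ℕ} (I : IP m n) (u : Fin m → ℝ) : ℤ :=
  ⌊∑ i, u i * (I.b i : ℝ)⌋

/-- The IP obtained by simultaneously adding the `k` Chvátal–Gomory cuts with parameters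
`u 0, …, u (k - 1)`, each computed from the current constraints, as new rows. -/
noncomputable def IP.addCuts {m n k : ℕ} (I : IP m n) (u : Fin k → Fin m → ℝ) : IP (m + k) n where
  c := I.c
  A := Matrix.of (Fin.append (fun i => I.A i) (fun l => I.cgRow (u l)))
  b := Fin.append I.b (fun l => I.cgRhs (u l))

/-- The number of constraints after `w` waves of `k` cuts, starting with `m` constraints. -/
def numRows (m k : ℕ) : ℕ → ℕ
  | 0 => m
  | w + 1 => numRows m k w + k

theorem numRows_eq (m k w : ℕ) : numRows m k w = m + k * w := by
  induction w with
  | zero => rfl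
  | succ w ih => rw [numRows, ih, Nat.mul_succ, Nat.add_assoc]

/-- Parameters of `W` waves of `k` cuts: the `l`-th cut of wave `w` (waves are counted from `0`)
has one parameter for each of the `m + k * w` constraints present before that wave. -/
abbrev WaveParams (m k W : ℕ) : Type :=
  (w : Fin W) → Fin k → Fin (numRows m k w) → ℝ

/-- The IP after the `W` waves of cuts have been added one wave after the other. -/
noncomputable def IP.applyWaves {m n k : ℕ} (I : IP m n) :
    (W : ℕ) → WaveParams m k W → IP (numRows m k W) n
  | 0, _ => I
  | W + 1, U => (I.applyWaves W (fun w => U w.castSucc)).addCuts (U (Fin.last W))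

/-! ### Branch-and-cut -/

/-- A branching constraint: `x i ≤ a` or `x i ≥ a`. -/
inductive Branch (n : ℕ) : Type
  | le (i : Fin n) (a : ℤ) : Branch n
  | ge (i : Fin n) (a : ℤ) : Branch n

/-- The points satisfying a branching constraint. -/
def Branch.Holds {n : ℕ} (x : Fin n → ℝ) : Branch n → Prop
  | .le i a => x i ≤ (a : ℝ)
  | .ge i a => (a : ℝ) ≤ x i

/-- A node of the search tree, given by the branching constraints on the path from the root to it
(the most recent one first); it stands for the input IP with these constraints added. -/
abbrev Node (n : ℕ) : Type := List (Branch n)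

/-- The feasible region of the LP relaxation at a node. -/
def lpRegion {m n : ℕ} (I : IP m n) (ν : Node n) : Set (Fin n → ℝ) :=
  {x | (∀ i, ∑ j, (I.A i j : ℝ) * x j ≤ (I.b i : ℝ)) ∧ (∀ j, 0 ≤ x j) ∧ ∀ β ∈ ν, β.Holds x}

/-- The objective value of a point. -/
def IP.obj {m n : ℕ} (I : IP m n) (x : Fin n → ℝ) : ℝ := ∑ j, I.c j * x j

/-- `x` is an optimal solution of the LP relaxation at the node `ν`. -/
def IsLPOptimal {m n : ℕ} (I : IP m n) (ν : Node n) (x : Fin n → ℝ) : Prop :=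
  x ∈ lpRegion I ν ∧ ∀ y ∈ lpRegion I ν, I.obj y ≤ I.obj x

/-- All coordinates of `x` are integers. -/
def IsIntegral {n : ℕ} (x : Fin n → ℝ) : Prop := ∀ j, ∃ a : ℤ, x j = (a : ℝ)

/-- The state of the search: all nodes of the tree built so far (the most recent ones first), its
leaves that are still to be processed, and the best integral solution found so far. -/
structure SearchState (n : ℕ) where
  nodes : List (Node n)
  active : List (Node n)
  incumbent : Option (Fin n → ℝ)

/-- The aspects of branch-and-cut that are fixed in advance: an LP solver, which returns an
optimal solution of the LP relaxation at a node if there is one; a node selection policy, which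
chooses one of the active leaves; and a variable selection policy. The latter two may
depend on the IP and on the entire state of the search. -/
structure Policy (m n : ℕ) where
  lpSol : IP m n → Node n → Fin n → ℝ
  lpSol_optimal : ∀ I ν, (∃ x, IsLPOptimal I ν x) → IsLPOptimal I ν (lpSol I ν)
  nodeSel : IP m n → (s : SearchState n) → s.active ≠ [] → Fin s.active.length
  varSel : IP m n → SearchState n → Node n → Fin n

/-- The incumbent is at least as good as `x`. -/
def NoBetter {m n : ℕ} (I : IP m n) (s : SearchState n) (x : Fin n → ℝ) : Prop :=
  ∃ z, s.incumbent = some z ∧ I.obj x ≤ I.obj z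

open Classical in
/-- One round of branch-and-cut with tree-size cap `κ`: select an active leaf and solve its LP
relaxation; fathom the leaf or branch on a variable. The search stops when no active leaf is left,
when the next branching would push the tree size above `κ`, or when an unbounded LP relaxation
(nonempty region, but no optimal solution) is met. -/
noncomputable def step {m n : ℕ} (κ : ℕ) (P : Policy m n) (I : IP m n) (s : SearchState n) :
    SearchState n :=
  if h : s.active = [] then s
  else
    let ν : Node n := s.active.get (P.nodeSel I s h)
    let rest : List (Node n) := s.active.eraseIdx (P.nodeSel I s h)
    let x : Fin n → ℝ := P.lpSol I ν
    if lpRegion I ν = ∅ then { s with active := rest }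
    else if ¬ IsLPOptimal I ν x then { s with active := [] }
    else if NoBetter I s x then { s with active := rest }
    else if IsIntegral x then { s with active := rest, incumbent := some x }
    else if s.nodes.length + 2 ≤ κ then
      let i : Fin n := P.varSel I s ν
      let left : Node n := Branch.le i ⌊x i⌋ :: ν
      let right : Node n := Branch.ge i ⌈x i⌉ :: ν
      { s with nodes := left :: right :: s.nodes, active := left :: right :: rest }
    else { s with active := [] }

/-- The initial state: the tree consists of the root only, which is active. -/
def initState (n : ℕ) : SearchState n := ⟨[[]], [[]], none⟩

/-- The final state of the search. By `active_finalState` the number of rounds is large enough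
for the search to have stopped. -/
noncomputable def finalState {m n : ℕ} (κ : ℕ) (P : Policy m n) (I : IP m n) : SearchState n :=
  (step κ P I)^[κ + 1] (initState n)

/-- The number of nodes of the tree that branch-and-cut builds. -/
noncomputable def treeSize {m n : ℕ} (κ : ℕ) (P : Policy m n) (I : IP m n) : ℕ :=
  (finalState κ P I).nodes.length

theorem step_measure {m n : ℕ} (κ : ℕ) (P : Policy m n) (I : IP m n) (s : SearchState n) :
    (step κ P I s).active.length + (κ - (step κ P I s).nodes.length) ≤
      s.active.length + (κ - s.nodes.length) - 1 ∨ (step κ P I s).active = [] := by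
  unfold step
  by_cases h : s.active = []
  · right; simp [h]
  · have hlen : (s.active.eraseIdx (P.nodeSel I s h)).length = s.active.length - 1 :=
      List.length_eraseIdx_of_lt (P.nodeSel I s h).2
    have hpos : 0 < s.active.length := List.length_pos_iff.2 h
    simp only [h, dite_false]
    split_ifs <;> simp_all <;> omega

/-- After the prescribed number of rounds the search has stopped. -/
theorem active_finalState {m n : ℕ} (κ : ℕ) (P : Policy m n) (I : IP m n) :
    (finalState κ P I).active = [] := by
  have key : ∀ t : ℕ, ((step κ P I)^[t] (initState n)).active.length +
      (κ - ((step κ P I)^[t] (initState n)).nodes.length) ≤ κ + 1 - t ∨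
      ((step κ P I)^[t] (initState n)).active = [] := by
    intro t
    induction t with
    | zero => left; simp [initState]; omega
    | succ t ih =>
      rw [Function.iterate_succ_apply']
      rcases ih with ih | ih
      · rcases step_measure κ P I ((step κ P I)^[t] (initState n)) with h | h
        · left; omega
        · exact Or.inr h
      · right; simp [step, ih]
  rcases key (κ + 1) with h | h
  · exact List.length_eq_zero_iff.1 (by unfold finalState; omega)
  · exact h

/-! ### Pseudo-dimension -/

/-- There are `N` inputs and `N` thresholds that the class `F` shatters. -/
def PseudoShatters {Y : Type*} (F : Set (Y → ℝ)) (N : ℕ) : Prop :=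
  ∃ (y : Fin N → Y) (r : Fin N → ℝ), ∀ σ : Fin N → Bool,
    ∃ f ∈ F, ∀ i, r i ≤ f (y i) ↔ σ i = true

/-- The pseudo-dimension of a class of real-valued functions: the largest `N` for which some `N`
inputs and thresholds are shattered (`⊤` if there is no largest one). -/
noncomputable def pdim {Y : Type*} (F : Set (Y → ℝ)) : ℕ∞ :=
  ⨆ N ∈ {N : ℕ | PseudoShatters F N}, (N : ℕ∞)

/-! ### The class of tree-size functions -/

/-- The IPs with `m` constraints, `n` variables, `‖A‖_{1,1} ≤ α` and `‖b‖₁ ≤ β`. -/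
abbrev BoundedIP (m n : ℕ) (α β : ℝ) : Type := {I : IP m n // I.normA ≤ α ∧ I.normb ≤ β}

/-- The functions mapping an IP with `‖A‖_{1,1} ≤ α` and `‖b‖₁ ≤ β` to the size of the tree that
branch-and-cut builds after `W` waves of `k` Chvátal–Gomory cuts with given parameters in `[0, 1]`
have been added at the root. -/
def treeSizeClass {m n k W : ℕ} (κ : ℕ) (P : Policy (numRows m k W) n) (α β : ℝ) :
    Set (BoundedIP m n α β → ℝ) :=
  {f | ∃ U : WaveParams m k W, (∀ w l i, U w l i ∈ Set.Icc (0 : ℝ) 1) ∧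
    f = fun I => (treeSize κ P (I.1.applyWaves W U) : ℝ)}

end BranchCut

/-! Branch-and-cut is a black box here: the tree size depends on the cut parameters only through the
IP they produce. If `N` IPs are shattered, the `2 ^ N` patterns need `2 ^ N` different tuples of
resulting IPs. With the `N` IPs side by side in one integer matrix `G` of `N (n + 1)` columns
(`stack`), a cut with parameter `u` appends the row `⌊uᵀG⌋`, so it suffices to count the matrices
reachable by appending `k W` such rows.

For a fixed `G` with at most `d = m + k W` rows, Pajor's inequality bounds the number of vectors
`⌊uᵀG⌋` by the number of shattered sets of (column, threshold) pairs. The columns of a shattered set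
are distinct and linearly independent, so there are at most `d` of them, and its thresholds form an
integer point of the zonotope `{uᵀG : u ∈ [0,1]^κ}` restricted to these columns
(`ThresholdShatters.exists_eq`). A volume comparison (`card_zonotope_le`) bounds the number of such
points by `(4 d) ^ d` times the largest minor of the rows of `G` together with the unit vectors.

Minors grow slowly: `⌊uᵀG⌋` combines rows of `G` and unit vectors with coefficients in `[-1, 1]`, so
by multilinearity each cut costs a factor of at most `2 d` (`MinorBound.insert_floorCombo`). All
cuts together cost `(2 d) ^ (k W) ≤ (2 d) ^ d`, no more than the other factors allow. Hence `2 ^ N ≤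
(8 d³ a (N (n + 1) + 1)) ^ (d k W)` with `a = ⌊α + β⌋`, and `d k W ≤ 2 m k² W²`; solving for `N`
gives the bound. -/

namespace BranchCut
open Finset

/-! ### Integer points of zonotopes -/

/-- A family of vectors containing the standard basis has a subfamily of maximal volume, and every
vector of the family is a combination of that subfamily with coefficients in `[-1, 1]`. -/
theorem exists_maxVolume_basis {τ a : Type*} [Fintype τ] [DecidableEq τ] [Fintype a]
    (v : a → τ → ℝ) (e : τ → a) (he : ∀ j, v (e j) = Pi.single j 1) :
    ∃ f : τ → a, ∀ x : a, ∃ c : τ → ℝ, (∀ i, |c i| ≤ 1) ∧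
      v x = ∑ i, c i • v (f i) := by
  classical
  have : Nonempty (τ → a) := ⟨e⟩
  obtain ⟨f, hf⟩ := Finite.exists_max
    (fun f : τ → a => |(Matrix.of fun i => v (f i)).det|)
  refine ⟨f, fun x => ?_⟩
  set B : Matrix τ τ ℝ := Matrix.of fun i => v (f i) with hB
  have h1 : (1 : ℝ) ≤ |B.det| := by
    have := hf e
    have h2 : (Matrix.of fun i => v (e i)) = (1 : Matrix τ τ ℝ) := by
      ext i j
      simp [he, Matrix.one_apply, Pi.single_apply, eq_comm]
    rw [h2] at this
    simpa using this
  have hB0 : B.det ≠ 0 := fun h => by rw [h] at h1; norm_num at h1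
  have hu : IsUnit B.det := isUnit_iff_ne_zero.2 hB0
  have hx : v x = ∑ i, (Matrix.vecMul (v x) B⁻¹) i • B i := by
    have : Matrix.vecMul (Matrix.vecMul (v x) B⁻¹) B = v x := by
      rw [Matrix.vecMul_vecMul, Matrix.nonsing_inv_mul _ hu, Matrix.vecMul_one]
    conv_lhs => rw [← this]
    rw [Matrix.vecMul_eq_sum]
  refine ⟨Matrix.vecMul (v x) B⁻¹, fun i => ?_, hx⟩
  -- Cramer's rule: the `i`-th coefficient is the ratio of the determinant after exchanging row `i`
  -- for `v x` to the maximal one, hence at most 1 in absolute value.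
  have h3 : (B.updateRow i (v x)).det = (Matrix.vecMul (v x) B⁻¹) i * B.det := by
    conv_lhs => rw [hx]
    rw [Matrix.det_updateRow_sum, smul_eq_mul]
  have h4 : B.updateRow i (v x) = Matrix.of fun l => v (Function.update f i x l) := by
    ext l j
    by_cases hl : l = i
    · subst hl; simp
    · simp [hl, hB]
  have h5 := hf (Function.update f i x)
  rw [← h4, h3, abs_mul] at h5
  have : 0 < |B.det| := by linarith
  by_contra hcon
  push Not at hcon
  nlinarith

/-- Integer points of the zonotope spanned by the rows of an integer matrix. -/
theorem card_zonotope_le {κ τ : Type*} [Fintype κ] [Fintype τ] [DecidableEq τ]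
    (G : κ → τ → ℤ) (M : ℕ)
    (hM : ∀ f : τ → κ ⊕ τ, |(Matrix.of fun i =>
      Sum.elim (fun l j => (G l j : ℝ)) (fun j => (Pi.single j 1 : τ → ℝ)) (f i)).det| ≤ M)
    (Z : Finset (τ → ℤ))
    (hZ : ∀ z ∈ Z, ∃ u : κ → ℝ, (∀ i, u i ∈ Set.Icc (0 : ℝ) 1) ∧
      ∀ j, (z j : ℝ) = ∑ i, u i * (G i j : ℝ)) :
    Z.card ≤ M * (2 * (Fintype.card κ + Fintype.card τ)) ^ Fintype.card τ := by
  classical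
  set v : κ ⊕ τ → τ → ℝ :=
    Sum.elim (fun l j => (G l j : ℝ)) (fun j => (Pi.single j 1 : τ → ℝ)) with hv
  obtain ⟨f, hf⟩ := exists_maxVolume_basis v Sum.inr (fun j => by simp [hv])
  choose c hc1 hc2 using hf
  set T : ℝ := ((Fintype.card κ + Fintype.card τ : ℕ) : ℝ) with hT
  set B : Matrix τ τ ℝ := Matrix.of fun i => v (f i) with hB
  set Q : (τ → ℤ) → Set (τ → ℝ) := fun z => Set.pi Set.univ fun j => Set.Ico (z j : ℝ) (z j + 1)
    with hQ
  -- The unit cube at an integer point of the zonotope only needs the unit vectors as additional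
  -- generators. Rewriting all `T` generators in the maximal-volume basis puts these disjoint cubes
  -- into one parallelepiped of volume `|det B| (2 T) ^ |τ|`.
  have hsub : ∀ z ∈ Z, Q z ⊆ Matrix.toLin' B.transpose '' Set.Icc (fun _ => -T) (fun _ => T) := by
    intro z hz y hy
    obtain ⟨u, hu, huz⟩ := hZ z hz
    have hy' : ∀ j, (z j : ℝ) ≤ y j ∧ y j < z j + 1 := fun j => hy j (Set.mem_univ j)
    set w : κ ⊕ τ → ℝ := Sum.elim u (fun j => y j - z j) with hw
    have hw1 : ∀ x, |w x| ≤ 1 := by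
      rintro (i | j)
      · simp only [hw, Sum.elim_inl]
        rw [abs_of_nonneg (hu i).1]; exact (hu i).2
      · simp only [hw, Sum.elim_inr]
        rw [abs_of_nonneg (by linarith [(hy' j).1])]; linarith [(hy' j).2]
    have hyw : y = ∑ x, w x • v x := by
      ext j
      rw [Finset.sum_apply, Fintype.sum_sum_type]
      simp only [hw, hv, Sum.elim_inl, Sum.elim_inr, Pi.smul_apply, smul_eq_mul, Pi.single_apply]
      simp [← huz]
    have hbd : ∀ i, |∑ x, w x * c x i| ≤ T := by
      intro i
      calc |∑ x, w x * c x i| ≤ ∑ x, |w x * c x i| := Finset.abs_sum_le_sum_abs _ _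
        _ ≤ ∑ _x : κ ⊕ τ, (1 : ℝ) := Finset.sum_le_sum fun x _ => by
            rw [abs_mul]
            exact mul_le_one₀ (hw1 x) (abs_nonneg _) (hc1 x i)
        _ = T := by simp [hT]
    refine ⟨fun i => ∑ x, w x * c x i, ⟨fun i => (abs_le.1 (hbd i)).1,
      fun i => (abs_le.1 (hbd i)).2⟩, ?_⟩
    rw [Matrix.toLin'_apply, Matrix.mulVec_transpose, Matrix.vecMul_eq_sum, hyw]
    have : ∀ x, w x • v x = ∑ i, (w x * c x i) • B i := by
      intro x
      rw [hc2 x, Finset.smul_sum]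
      exact Finset.sum_congr rfl fun i _ => by rw [smul_smul]; rfl
    simp_rw [this]
    rw [Finset.sum_comm]
    simp_rw [Finset.sum_smul]
  have hvolQ : ∀ z, MeasureTheory.volume (Q z) = 1 := by
    intro z
    simp [hQ, Real.volume_pi_Ico]
  have hmeas : ∀ z, MeasurableSet (Q z) := fun z =>
    MeasurableSet.univ_pi fun j => measurableSet_Ico
  have hdisj : (Z : Set (τ → ℤ)).PairwiseDisjoint Q := by
    intro z _ z' _ hne
    refine Set.disjoint_left.2 fun y hy hy' => hne ?_
    ext j
    have h1 := hy j (Set.mem_univ j)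
    have h2 := hy' j (Set.mem_univ j)
    rw [← Int.floor_eq_iff.2 h1, ← Int.floor_eq_iff.2 h2]
  have hT0 : 0 ≤ T := by positivity
  have h1 : (Z.card : ENNReal) ≤ MeasureTheory.volume
      (Matrix.toLin' B.transpose '' Set.Icc (fun _ : τ => -T) (fun _ => T)) := by
    calc (Z.card : ENNReal) = ∑ z ∈ Z, MeasureTheory.volume (Q z) := by simp [hvolQ]
      _ = MeasureTheory.volume (⋃ z ∈ Z, Q z) :=
        (MeasureTheory.measure_biUnion_finset hdisj fun z _ => hmeas z).symm
      _ ≤ _ := MeasureTheory.measure_mono (Set.iUnion₂_subset hsub)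
  rw [MeasureTheory.Measure.addHaar_image_linearMap, LinearMap.det_toLin', Matrix.det_transpose,
    Real.volume_Icc_pi] at h1
  have h2 : ENNReal.ofReal |B.det| ≤ (M : ENNReal) := by
    rw [← ENNReal.ofReal_natCast]
    exact ENNReal.ofReal_le_ofReal (hM f)
  have h3 : (∏ _i : τ, ENNReal.ofReal (T - -T)) =
      (((2 * (Fintype.card κ + Fintype.card τ)) ^ Fintype.card τ : ℕ) : ENNReal) := by
    rw [Finset.prod_const, Finset.card_univ, Nat.cast_pow]
    congr 1
    rw [← ENNReal.ofReal_natCast, hT]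
    congr 1
    push_cast; ring
  rw [h3] at h1
  have h4 := h1.trans (mul_le_mul_left h2 _)
  exact_mod_cast h4


/-! ### Shattered sets of thresholds -/

/-- The integer vectors `⌊uᵀG⌋` with `u ∈ [0,1]^κ`. -/
def floorCombos {κ ι : Type*} [Fintype κ] (G : κ → ι → ℤ) : Set (ι → ℤ) :=
  {h | ∃ u : κ → ℝ, (∀ i, u i ∈ Set.Icc (0 : ℝ) 1) ∧ h = fun j => ⌊∑ i, u i * (G i j : ℝ)⌋}

/-- All patterns of a set of (column, threshold) pairs are realized by points of the cube. -/
def ThresholdShatters {κ ι : Type*} [Fintype κ] (G : κ → ι → ℤ) (s : Finset (ι × ℤ)) : Prop :=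
  ∀ t ⊆ s, ∃ u : κ → ℝ, (∀ i, u i ∈ Set.Icc (0 : ℝ) 1) ∧
    ∀ q ∈ s, q ∈ t ↔ (q.2 : ℝ) ≤ ∑ i, u i * (G i q.1 : ℝ)

namespace ThresholdShatters

variable {κ ι : Type*} [Fintype κ] {G : κ → ι → ℤ} {s : Finset (ι × ℤ)}

/-- Of two thresholds on one column, the larger cannot be met without the smaller. -/
theorem injOn_fst (hs : ThresholdShatters G s) : Set.InjOn Prod.fst (s : Set (ι × ℤ)) := by
  classical
  have key : ∀ q ∈ s, ∀ q' ∈ s, q.1 = q'.1 → q.2 ≤ q'.2 := by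
    intro q hq q' hq' h
    by_contra hlt
    push Not at hlt
    obtain ⟨u, -, hu⟩ := hs {q} (by simpa using hq)
    have h1 := (hu q hq).1 (by simp)
    have h2 : q' ∉ ({q} : Finset (ι × ℤ)) := by
      simp only [mem_singleton]
      rintro rfl
      exact lt_irrefl _ hlt
    rw [hu q' hq', ← h] at h2
    have : (q'.2 : ℝ) < q.2 := by exact_mod_cast hlt
    linarith
  intro q hq q' hq' h
  exact Prod.ext h (le_antisymm (key q hq q' hq' h) (key q' hq' q hq h.symm))

/-- The pattern is read off the signs of `l`: thresholds are met exactly where `l` is nonpositive,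
so every summand is nonpositive. This is the only form in which the next two lemmas use shattering.
-/
theorem exists_sum_le (hs : ThresholdShatters G s) (l : s → ℝ) :
    ∃ u : κ → ℝ, (∀ i, u i ∈ Set.Icc (0 : ℝ) 1) ∧
      ∑ q, l q * ((∑ i, u i * (G i q.1.1 : ℝ)) - q.1.2) ≤ 0 ∧
      ((∃ q, 0 < l q) → ∑ q, l q * ((∑ i, u i * (G i q.1.1 : ℝ)) - q.1.2) < 0) := by
  classical
  obtain ⟨u, hu, h⟩ := hs (s.filter fun q => ∀ hq : q ∈ s, l ⟨q, hq⟩ ≤ 0) (filter_subset _ _)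
  have h' : ∀ q : s, l q ≤ 0 ↔ (q.1.2 : ℝ) ≤ ∑ i, u i * (G i q.1.1 : ℝ) := by
    intro q
    rw [← h q.1 q.2]
    simp
  have hle : ∀ q : s, l q * ((∑ i, u i * (G i q.1.1 : ℝ)) - q.1.2) ≤ 0 := by
    intro q
    by_cases hq : l q ≤ 0
    · exact mul_nonpos_of_nonpos_of_nonneg hq (sub_nonneg.2 ((h' q).1 hq))
    · have := mt (h' q).2 hq
      push Not at this hq
      exact mul_nonpos_of_nonneg_of_nonpos hq.le (by linarith)
  refine ⟨u, hu, Finset.sum_nonpos fun q _ => hle q, ?_⟩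
  rintro ⟨q, hq⟩
  refine Finset.sum_neg' (fun q _ => hle q) ⟨q, mem_univ _, ?_⟩
  have := mt (h' q).2 (not_le.2 hq)
  push Not at this
  exact mul_neg_of_pos_of_neg hq (by linarith)

/-- The columns of a shattered set are linearly independent. Under a relation `g`, the sum in
`exists_sum_le` no longer depends on `u`; applied to `g` and `-g`, the lemma makes this constant
zero, yet negative or positive as soon as some coefficient is nonzero. -/
theorem card_le (hs : ThresholdShatters G s) : s.card ≤ Fintype.card κ := by
  classical
  have hli : LinearIndependent ℝ (fun (q : s) (i : κ) => (G i q.1.1 : ℝ)) := by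
    rw [Fintype.linearIndependent_iff]
    intro g hg
    have hzero : ∀ u : κ → ℝ, ∑ q, g q * ∑ i, u i * (G i q.1.1 : ℝ) = 0 := by
      intro u
      simp_rw [Finset.mul_sum]
      rw [Finset.sum_comm]
      refine Finset.sum_eq_zero fun i _ => ?_
      have := congrFun hg i
      simp only [Finset.sum_apply, Pi.smul_apply, smul_eq_mul, Pi.zero_apply] at this
      calc ∑ q, g q * (u i * (G i q.1.1 : ℝ)) = u i * ∑ q, g q * (G i q.1.1 : ℝ) := by
            rw [Finset.mul_sum]; exact Finset.sum_congr rfl fun q _ => by ring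
        _ = 0 := by rw [this, mul_zero]
    obtain ⟨u, -, h1, h1'⟩ := hs.exists_sum_le g
    obtain ⟨u', -, h2, h2'⟩ := hs.exists_sum_le (fun q => - g q)
    simp only [mul_sub, neg_mul, Finset.sum_sub_distrib, Finset.sum_neg_distrib, hzero] at *
    intro q
    rcases lt_trichotomy (g q) 0 with h | h | h
    · have := h2' ⟨q, by linarith⟩
      linarith
    · exact h
    · have := h1' ⟨q, h⟩
      linarith
  simpa using hli.fintype_card_le_finrank

/-- Otherwise a linear functional strictly separates the threshold vector from the compact convex
image of the cube, and the sign pattern of that functional yields a point of the image on the wrong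
side. -/
theorem exists_eq (hs : ThresholdShatters G s) :
    ∃ u : κ → ℝ, (∀ i, u i ∈ Set.Icc (0 : ℝ) 1) ∧
      ∀ q ∈ s, (q.2 : ℝ) = ∑ i, u i * (G i q.1 : ℝ) := by
  classical
  set T : (κ → ℝ) →ₗ[ℝ] (s → ℝ) :=
    Matrix.toLin' (Matrix.of fun (q : s) (i : κ) => (G i q.1.1 : ℝ)) with hT
  have hTu : ∀ u q, T u q = ∑ i, u i * (G i q.1.1 : ℝ) := by
    intro u q
    simp [hT, Matrix.mulVec, dotProduct, mul_comm]
  by_cases hz : (fun q : s => (q.1.2 : ℝ)) ∈ T '' Set.Icc 0 1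
  · obtain ⟨u, hu, h⟩ := hz
    refine ⟨u, fun i => ⟨hu.1 i, hu.2 i⟩, fun q hq => ?_⟩
    have := congrFun h ⟨q, hq⟩
    rw [hTu] at this
    exact this.symm
  · exfalso
    have hcv : Convex ℝ (T '' Set.Icc 0 1) := (convex_Icc 0 1).linear_image T
    have hcl : IsClosed (T '' Set.Icc 0 1) :=
      (isCompact_Icc.image T.continuous_of_finiteDimensional).isClosed
    obtain ⟨f, c, hfc, hfb⟩ := geometric_hahn_banach_point_closed hcv hcl hz
    have hf : ∀ y : s → ℝ, f y = ∑ q, f (Pi.single q 1) * y q := by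
      intro y
      have := LinearMap.pi_apply_eq_sum_univ (f : (s → ℝ) →ₗ[ℝ] ℝ) y
      simp only [ContinuousLinearMap.coe_coe, smul_eq_mul] at this
      rw [this]
      refine Finset.sum_congr rfl fun q _ => ?_
      rw [mul_comm]
      congr 2
      ext j
      simp [Pi.single_apply, eq_comm]
    obtain ⟨u, hu, h1, -⟩ := hs.exists_sum_le (fun q => f (Pi.single q 1))
    have h2 := hfb (T u) ⟨u, ⟨fun i => (hu i).1, fun i => (hu i).2⟩, rfl⟩
    rw [hf] at h2 hfc
    simp only [mul_sub, Finset.sum_sub_distrib] at h1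
    simp only [hTu] at h2
    linarith

end ThresholdShatters

/-! ### Counting the possible cuts by minors -/

/-- All square submatrices, with at most `d` columns, of a family of vectors have determinants of
absolute value at most `M`. -/
def MinorBound {ι : Type*} [DecidableEq ι] (V : Set (ι → ℝ)) (d M : ℕ) : Prop :=
  ∀ I : Finset ι, I.card ≤ d → ∀ f : I → ι → ℝ, (∀ i, f i ∈ V) →
    |(Matrix.of fun i j : I => f i j).det| ≤ (M : ℝ)

/-- The rows of an integer matrix together with the standard basis. -/
def rowsAndUnits {κ ι : Type*} [DecidableEq ι] (G : κ → ι → ℤ) : Set (ι → ℝ) :=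
  Set.range (fun i j => (G i j : ℝ)) ∪ Set.range (fun j : ι => (Pi.single j 1 : ι → ℝ))


theorem card_filter_card_le {ι : Type*} [Fintype ι] [DecidableEq ι] (d : ℕ) :
    (univ.filter fun I : Finset ι => I.card ≤ d).card ≤ (Fintype.card ι + 1) ^ d := by
  have hsub : (univ.filter fun I : Finset ι => I.card ≤ d) ⊆
      univ.image fun g : Fin d → Option ι => (univ.image g).eraseNone := by
    intro I hI
    have hI : I.card ≤ d := by simpa using hI
    refine mem_image.2 ⟨fun i => if h : i.1 < I.card then
      some (I.equivFin.symm ⟨i.1, h⟩ : ι) else none, mem_univ _, ?_⟩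
    ext j
    simp only [mem_eraseNone, mem_image, mem_univ, true_and]
    constructor
    · rintro ⟨i, hi⟩
      split_ifs at hi with h
      · rw [← Option.some.inj hi]
        exact Subtype.property _
    · intro hj
      refine ⟨⟨I.equivFin ⟨j, hj⟩, lt_of_lt_of_le (Fin.is_lt _) hI⟩, ?_⟩
      simp
  calc _ ≤ _ := card_le_card hsub
    _ ≤ _ := card_image_le
    _ = _ := by simp

/-- Once the column set `I` is fixed, a shattered set amounts to its vector of thresholds, an
integer point of the zonotope spanned by the rows restricted to `I`. -/
theorem card_thresholdShatters_le {κ ι : Type*} [Fintype κ] [DecidableEq ι]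
    {G : κ → ι → ℤ} {d M : ℕ} (hκ : Fintype.card κ ≤ d) (hM : MinorBound (rowsAndUnits G) d M)
    (S : Finset (Finset (ι × ℤ))) (I : Finset ι)
    (hS : ∀ s ∈ S, ThresholdShatters G s ∧ s.image Prod.fst = I) :
    S.card ≤ M * (4 * d) ^ d := by
  rcases S.eq_empty_or_nonempty with rfl | ⟨s₀, hs₀⟩
  · simp
  have hId : I.card ≤ Fintype.card κ := by
    rw [← (hS s₀ hs₀).2]
    exact card_image_le.trans (hS s₀ hs₀).1.card_le
  -- For `s ∈ S` the sum has exactly one term, the threshold of `s` on column `j`.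
  set z : Finset (ι × ℤ) → I → ℤ := fun s j => ∑ q ∈ s with q.1 = (j : ι), q.2 with hz
  have hzmem : ∀ s ∈ S, ∀ q (hq : q ∈ s) (hj : q.1 ∈ I), z s ⟨q.1, hj⟩ = q.2 := by
    intro s hs q hq hj
    have : (s.filter fun q' => q'.1 = q.1) = {q} := by
      ext q'
      simp only [mem_filter, mem_singleton]
      constructor
      · rintro ⟨h1, h2⟩
        exact (hS s hs).1.injOn_fst h1 hq h2
      · rintro rfl
        exact ⟨hq, rfl⟩
    simp [hz, this]
  have hmemI : ∀ s ∈ S, ∀ q ∈ s, q.1 ∈ I := by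
    intro s hs q hq
    rw [← (hS s hs).2]
    exact mem_image_of_mem _ hq
  have hinj : Set.InjOn z (S : Set (Finset (ι × ℤ))) := by
    have key : ∀ s ∈ S, ∀ s' ∈ S, z s = z s' → s ⊆ s' := by
      intro s hs s' hs' h q hq
      have hqI := hmemI s hs q hq
      have h1 : q.1 ∈ s'.image Prod.fst := by rw [(hS s' hs').2]; exact hqI
      obtain ⟨q', hq', hqq⟩ := mem_image.1 h1
      have h2 := hzmem s hs q hq hqI
      have h3 := hzmem s' hs' q' hq' (hqq ▸ hqI)
      have h4 : q' = q := by
        refine Prod.ext hqq ?_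
        rw [← h2, ← h3, h]
        congr 1
        exact Subtype.ext hqq
      exact h4 ▸ hq'
    intro s hs s' hs' h
    exact (key s hs s' hs' h).antisymm (key s' hs' s hs h.symm)
  rw [← card_image_of_injOn hinj]
  refine (card_zonotope_le (τ := I) (fun i j => G i j) M ?_ (S.image z) ?_).trans ?_
  · intro f
    have := hM I (hId.trans hκ) (fun i => Sum.elim (fun l j => (G l j : ℝ))
      (fun j : I => (Pi.single (j : ι) 1 : ι → ℝ)) (f i)) (fun i => by
        rcases f i with l | j
        · exact Or.inl ⟨l, rfl⟩
        · exact Or.inr ⟨j, rfl⟩)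
    convert this using 3
    ext i j
    simp only [Matrix.of_apply]
    rcases f i with l | j'
    · rfl
    · simp only [Sum.elim_inr, Pi.single_apply]
      exact if_congr Subtype.ext_iff rfl rfl
  · intro y hy
    obtain ⟨s, hs, rfl⟩ := mem_image.1 hy
    obtain ⟨u, hu, h⟩ := (hS s hs).1.exists_eq
    refine ⟨u, hu, fun j => ?_⟩
    have h1 : (j : ι) ∈ s.image Prod.fst := by rw [(hS s hs).2]; exact j.2
    obtain ⟨q, hq, hqj⟩ := mem_image.1 h1
    have h2 := hzmem s hs q hq (hqj ▸ j.2)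
    have h3 : (⟨q.1, hqj ▸ j.2⟩ : I) = j := Subtype.ext hqj
    rw [h3] at h2
    rw [h2, h q hq, hqj]
  · have h1 : Fintype.card I ≤ d := by
      rw [Fintype.card_coe]; exact hId.trans hκ
    refine Nat.mul_le_mul_left _ ?_
    rcases Nat.eq_zero_or_pos d with rfl | hd
    · simp [Nat.le_zero.1 h1]
    · calc _ ≤ (4 * d) ^ Fintype.card I := Nat.pow_le_pow_left (by omega) _
        _ ≤ _ := Nat.pow_le_pow_right (by omega) h1

/-- Each vector is encoded by its subgraph, the pairs (column, threshold) that it meets. Pajor's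
inequality bounds the number of subgraphs by the number of sets they shatter, which are then sorted
by their column sets. -/
theorem card_le_of_subset_floorCombos {κ ι : Type*} [Fintype κ] [Fintype ι] [DecidableEq ι]
    {G : κ → ι → ℤ} {d M : ℕ} (hκ : Fintype.card κ ≤ d) (hM : MinorBound (rowsAndUnits G) d M)
    (P : Finset (ι → ℤ)) (hP : ∀ p ∈ P, p ∈ floorCombos G) :
    P.card ≤ M * (4 * d) ^ d * (Fintype.card ι + 1) ^ d := by
  classical
  -- A crude common bound on the entries; it keeps the subgraphs finite and does not enter the final
  -- count.
  set R : ℤ := ∑ p ∈ P, ∑ j, |p j| with hR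
  have hRp : ∀ p ∈ P, ∀ j, |p j| ≤ R := fun p hp j =>
    (single_le_sum (f := fun j => |p j|) (fun _ _ => abs_nonneg _) (mem_univ j)).trans
      (single_le_sum (f := fun p : ι → ℤ => ∑ j, |p j|)
        (fun _ _ => sum_nonneg fun _ _ => abs_nonneg _) hp)
  set F : (ι → ℤ) → Finset (ι × ℤ) := fun p =>
    (univ ×ˢ Icc (-R) R).filter fun q => q.2 ≤ p q.1 with hF
  have hFm : ∀ p q, q ∈ F p ↔ q.2 ∈ Icc (-R) R ∧ q.2 ≤ p q.1 := by
    intro p q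
    simp [hF]
  have hinj : Set.InjOn F (P : Set (ι → ℤ)) := by
    have key : ∀ p ∈ P, ∀ p' ∈ P, F p = F p' → ∀ j, p j ≤ p' j := by
      intro p hp p' _ h j
      have h1 : (j, p j) ∈ F p := (hFm _ _).2
        ⟨mem_Icc.2 (abs_le.1 (hRp p hp j)), le_rfl⟩
      rw [h] at h1
      exact ((hFm _ _).1 h1).2
    intro p hp p' hp' h
    exact funext fun j => le_antisymm (key p hp p' hp' h j) (key p' hp' p hp h.symm j)
  have hsh : ∀ s ∈ (P.image F).shatterer, ThresholdShatters G s := by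
    intro s hs
    rw [mem_shatterer] at hs
    have hs1 : ∀ q ∈ s, q.2 ∈ Icc (-R) R := by
      obtain ⟨t, ht, hst⟩ := hs.exists_superset
      obtain ⟨p, -, rfl⟩ := mem_image.1 ht
      exact fun q hq => ((hFm _ _).1 (hst hq)).1
    intro t ht
    obtain ⟨A, hA, hAt⟩ := hs ht
    obtain ⟨p, hp, rfl⟩ := mem_image.1 hA
    obtain ⟨u, hu, hpu⟩ := hP p hp
    refine ⟨u, hu, fun q hq => ?_⟩
    -- For an integer threshold, the floor meets it exactly when the real combination does.
    rw [← hAt, mem_inter, hFm, ← Int.le_floor, congrFun hpu q.1]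
    exact ⟨fun h => h.2.2, fun h => ⟨hq, hs1 q hq, h⟩⟩
  calc P.card = (P.image F).card := (card_image_of_injOn hinj).symm
    _ ≤ (P.image F).shatterer.card := card_le_card_shatterer _
    _ ≤ M * (4 * d) ^ d * (univ.filter fun I : Finset ι => I.card ≤ d).card := by
      refine card_le_mul_card_image_of_maps_to (f := fun s => s.image Prod.fst) ?_ _ ?_
      · intro s hs
        exact mem_filter.2 ⟨mem_univ _, card_image_le.trans ((hsh s hs).card_le.trans hκ)⟩
      · intro I _
        refine card_thresholdShatters_le hκ hM _ I fun s hs => ?_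
        rw [mem_filter] at hs
        exact ⟨hsh s hs.1, hs.2⟩
    _ ≤ _ := Nat.mul_le_mul_left _ (card_filter_card_le d)

theorem finite_floorCombos {κ ι : Type*} [Fintype κ] [Fintype ι] [DecidableEq ι]
    {G : κ → ι → ℤ} {d M : ℕ} (hκ : Fintype.card κ ≤ d) (hM : MinorBound (rowsAndUnits G) d M) :
    (floorCombos G).Finite ∧
      (floorCombos G).ncard ≤ M * (4 * d) ^ d * (Fintype.card ι + 1) ^ d := by
  have hfin : (floorCombos G).Finite := by
    by_contra hinf
    obtain ⟨P, hP, hc⟩ := Set.Infinite.exists_subset_card_eq hinf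
      (M * (4 * d) ^ d * (Fintype.card ι + 1) ^ d + 1)
    have := card_le_of_subset_floorCombos hκ hM P (fun p hp => hP hp)
    omega
  refine ⟨hfin, ?_⟩
  rw [Set.ncard_eq_toFinset_card _ hfin]
  exact card_le_of_subset_floorCombos hκ hM _ (fun p hp => by simpa using hp)

/-! ### Minors after adding cuts -/

/-- Expanding along the new row gives at most `|κ| + |I| ≤ 2 d` old minors with coefficients in
`[-1, 1]`. The set `V` may exceed `rowsAndUnits G`, so that the cuts of one wave, all computed from
the same `G`, can be inserted one at a time. -/
theorem MinorBound.insert_floorCombo {κ ι : Type*} [Fintype κ] [DecidableEq ι]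
    {G : κ → ι → ℤ} {d M : ℕ} {V : Set (ι → ℝ)} (hκ : Fintype.card κ ≤ d) (hd : 1 ≤ d)
    (hV : rowsAndUnits G ⊆ V) (hM : MinorBound V d M) {h : ι → ℤ} (hh : h ∈ floorCombos G) :
    MinorBound (insert (fun j => (h j : ℝ)) V) d (2 * d * M) := by
  obtain ⟨u, hu, rfl⟩ := hh
  set x : ι → ℝ := fun j => ((⌊∑ i, u i * (G i j : ℝ)⌋ : ℤ) : ℝ) with hx
  have hMM : (M : ℝ) ≤ (2 * d * M : ℕ) := by
    exact_mod_cast Nat.le_mul_of_pos_left M (by omega)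
  intro I hI f hf
  by_cases h0 : ∀ i, f i ∈ V
  · exact (hM I hI f h0).trans hMM
  push Not at h0
  obtain ⟨i₀, hi₀⟩ := h0
  have hfx : f i₀ = x := (hf i₀).resolve_right hi₀
  -- A second occurrence of the new row makes the determinant vanish.
  by_cases h1 : ∃ i, i ≠ i₀ ∧ f i = x
  · obtain ⟨i, hi, hix⟩ := h1
    rw [Matrix.det_zero_of_row_eq hi (by ext j; simp [hix, hfx]), abs_zero]
    positivity
  push Not at h1
  have hfV : ∀ i, i ≠ i₀ → f i ∈ V := fun i hi => (hf i).resolve_left (h1 i hi)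
  set B : Matrix I I ℝ := Matrix.of fun i j : I => f i j with hB
  have hrep : ∀ y ∈ V, |(B.updateRow i₀ fun j => y j).det| ≤ M := by
    intro y hy
    have h2 := hM I hI (Function.update f i₀ y) (fun i => by
      by_cases hi : i = i₀
      · subst hi; simpa using hy
      · simpa [hi] using hfV i hi)
    convert h2 using 3
    ext i j
    by_cases hi : i = i₀
    · subst hi; simp
    · simp [hi, hB]
  -- The floor is the combination minus its fractional parts, which are coefficients of unit
  -- vectors.
  have hrow : (fun j : I => x j) = (∑ i, u i • fun j : I => (G i j : ℝ)) +
      ∑ l : I, (-Int.fract (∑ i, u i * (G i l : ℝ))) •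
        fun j : I => (Pi.single (l : ι) 1 : ι → ℝ) j := by
    ext j
    simp only [Pi.add_apply, Finset.sum_apply, Pi.smul_apply, smul_eq_mul, Pi.single_apply, hx]
    have : ∀ l : I, ((j : ι) = l) ↔ (j = l) := fun l => Subtype.ext_iff.symm
    simp only [this, mul_ite, mul_one, mul_zero, Finset.sum_ite_eq, mem_univ, if_true]
    rw [← sub_eq_add_neg, Int.self_sub_fract]
  have hBx : B = B.updateRow i₀ fun j => x j := by
    ext i j
    by_cases hi : i = i₀
    · subst hi; simp [hB, hfx]
    · simp [hi]
  have hsum : B.det = (∑ i, u i * (B.updateRow i₀ fun j : I => (G i j : ℝ)).det) +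
      ∑ l : I, (-Int.fract (∑ i, u i * (G i l : ℝ))) *
        (B.updateRow i₀ fun j : I => (Pi.single (l : ι) 1 : ι → ℝ) j).det := by
    have hlin : ∀ y : I → ℝ, (B.updateRow i₀ y).det =
        (Matrix.detRowAlternating.toMultilinearMap.toLinearMap B i₀) y := fun y => rfl
    conv_lhs => rw [hBx, hrow]
    simp only [hlin, map_add, map_sum, map_smul, smul_eq_mul]
  have hcard : Fintype.card I ≤ d := by rwa [Fintype.card_coe]
  rw [hsum]
  calc _ ≤ (∑ i, |u i * (B.updateRow i₀ fun j : I => (G i j : ℝ)).det|) +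
      ∑ l : I, |(-Int.fract (∑ i, u i * (G i l : ℝ))) *
        (B.updateRow i₀ fun j : I => (Pi.single (l : ι) 1 : ι → ℝ) j).det| :=
        (abs_add_le _ _).trans (add_le_add (abs_sum_le_sum_abs _ _) (abs_sum_le_sum_abs _ _))
    _ ≤ (∑ _i : κ, (M : ℝ)) + ∑ _l : I, (M : ℝ) := by
      refine add_le_add (sum_le_sum fun i _ => ?_) (sum_le_sum fun l _ => ?_)
      · rw [abs_mul, abs_of_nonneg (hu i).1]
        refine (mul_le_mul (hu i).2 (hrep _ (hV (Or.inl ⟨i, rfl⟩))) (abs_nonneg _)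
          zero_le_one).trans_eq (one_mul _)
      · rw [abs_mul, abs_neg, abs_of_nonneg (Int.fract_nonneg _)]
        refine (mul_le_mul (Int.fract_lt_one _).le (hrep _ (hV (Or.inr ⟨l, rfl⟩)))
          (abs_nonneg _) zero_le_one).trans_eq (one_mul _)
    _ = ((Fintype.card κ + Fintype.card I : ℕ) : ℝ) * M := by
      simp; ring
    _ ≤ ((2 * d : ℕ) : ℝ) * M := by
      refine mul_le_mul_of_nonneg_right ?_ (Nat.cast_nonneg _)
      exact_mod_cast (by omega : Fintype.card κ + Fintype.card I ≤ 2 * d)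
    _ = _ := by push_cast; ring

theorem MinorBound.mono {ι : Type*} [DecidableEq ι] {d M : ℕ} {V V' : Set (ι → ℝ)}
    (hM : MinorBound V d M) (h : V' ⊆ V) : MinorBound V' d M :=
  fun I hI f hf => hM I hI f fun i => h (hf i)

theorem MinorBound.append {p k : ℕ} {ι : Type*} [DecidableEq ι]
    {G : Fin p → ι → ℤ} {d M : ℕ} (hp : p ≤ d) (hd : 1 ≤ d)
    (hM : MinorBound (rowsAndUnits G) d M) {h : Fin k → ι → ℤ} (hh : ∀ l, h l ∈ floorCombos G) :
    MinorBound (rowsAndUnits (Fin.append G h)) d ((2 * d) ^ k * M) := by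
  have key : ∀ s : Finset (Fin k), MinorBound
      (rowsAndUnits G ∪ (fun l j => (h l j : ℝ)) '' (s : Set (Fin k))) d
      ((2 * d) ^ s.card * M) := by
    intro s
    induction s using Finset.induction_on with
    | empty => simpa using hM
    | insert l s hl ih =>
      have := ih.insert_floorCombo (by simpa using hp) hd Set.subset_union_left (hh l)
      rw [card_insert_of_notMem hl, pow_succ', mul_assoc]
      convert this using 1
      rw [coe_insert, Set.image_insert_eq, Set.union_insert]
  have h1 := key univ
  rw [card_univ, Fintype.card_fin] at h1
  refine h1.mono ?_
  rintro _ (⟨i, rfl⟩ | ⟨j, rfl⟩)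
  · refine Fin.addCases (fun i => ?_) (fun l => ?_) i
    · exact Or.inl (Or.inl ⟨i, by simp⟩)
    · exact Or.inr ⟨l, by simp, by simp⟩
  · exact Or.inl (Or.inr ⟨j, rfl⟩)

theorem minorBound_of_entries_le {p : ℕ} {ι : Type*} [DecidableEq ι] {G : Fin p → ι → ℤ}
    {d a : ℕ} (hd : 1 ≤ d) (ha : 1 ≤ a) (hG : ∀ i j, |G i j| ≤ a) :
    MinorBound (rowsAndUnits G) d ((d * a) ^ d) := by
  intro I hI f hf
  have hent : ∀ i j : I, |f i j| ≤ (a : ℝ) := by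
    intro i j
    have ha' : (1 : ℝ) ≤ a := by exact_mod_cast ha
    rcases hf i with ⟨l, hl⟩ | ⟨l, hl⟩
    · rw [← hl]
      change |(G l j : ℝ)| ≤ a
      exact_mod_cast hG l j
    · rw [← hl]
      simp only [Pi.single_apply]
      split_ifs <;> simp
      · exact_mod_cast ha
  have h1 := Matrix.det_le (A := Matrix.of fun i j : I => f i j) (abv := AbsoluteValue.abs)
    (x := (a : ℝ)) hent
  rw [AbsoluteValue.abs_apply, Fintype.card_coe] at h1
  refine h1.trans ?_
  rw [nsmul_eq_mul]
  have h2 : (I.card.factorial) * a ^ I.card ≤ (d * a) ^ d := by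
    calc I.card.factorial * a ^ I.card ≤ I.card ^ I.card * a ^ I.card :=
          Nat.mul_le_mul_right _ (Nat.factorial_le_pow _)
      _ ≤ d ^ I.card * a ^ I.card := Nat.mul_le_mul_right _ (Nat.pow_le_pow_left hI _)
      _ = (d * a) ^ I.card := (mul_pow _ _ _).symm
      _ ≤ _ := Nat.pow_le_pow_right (Nat.mul_pos hd ha) hI
  exact_mod_cast h2


/-! ### Integer matrices reachable by waves of cuts -/

/-- The matrices reachable from `G₀` by appending `w` times `k` rows of the form `⌊uᵀG⌋`. -/
def reachable {ι : Type*} {m : ℕ} (k : ℕ) (G₀ : Fin m → ι → ℤ) :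
    (w : ℕ) → Set (Fin (numRows m k w) → ι → ℤ)
  | 0 => {G₀}
  | w + 1 => {H | ∃ G ∈ reachable k G₀ w, ∃ h : Fin k → ι → ℤ,
      (∀ l, h l ∈ floorCombos G) ∧ H = Fin.append G h}

theorem numRows_mono {m k w W : ℕ} (h : w ≤ W) : numRows m k w ≤ numRows m k W := by
  rw [numRows_eq, numRows_eq]
  exact Nat.add_le_add_left (Nat.mul_le_mul_left _ h) _

theorem minorBound_of_mem_reachable {ι : Type*} [DecidableEq ι] {m k d M : ℕ} (hd : 1 ≤ d)
    {G₀ : Fin m → ι → ℤ} (hM : MinorBound (rowsAndUnits G₀) d M) :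
    ∀ (w : ℕ), numRows m k w ≤ d → ∀ G ∈ reachable k G₀ w,
      MinorBound (rowsAndUnits G) d ((2 * d) ^ (k * w) * M)
  | 0, _, G, hG => by
    have hG : G = G₀ := hG
    subst hG
    have hM1 : (2 * d) ^ (k * 0) * M = M := by simp
    rw [hM1]
    exact hM
  | w + 1, hw, H, hH => by
    obtain ⟨G, hG, h, hh, rfl⟩ := hH
    have hw' : numRows m k w ≤ d := (numRows_mono (Nat.le_succ w)).trans hw
    have := (minorBound_of_mem_reachable hd hM w hw' G hG).append hw' hd hh
    rwa [← mul_assoc, ← pow_add, Nat.add_comm k, ← Nat.mul_succ] at this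

theorem MinorBound.of_le {ι : Type*} [DecidableEq ι] {d M M' : ℕ} {V : Set (ι → ℝ)}
    (hM : MinorBound V d M) (h : M ≤ M') : MinorBound V d M' :=
  fun I hI f hf => (hM I hI f hf).trans (by exact_mod_cast h)

/-- The bound on the number of choices for one cut is uniform over all waves, since row counts and
minors are estimated by their values for wave `W`. A wave therefore multiplies the count by at most
the `k`-th power of that bound. -/
theorem exists_finset_reachable {ι : Type*} [Fintype ι] [DecidableEq ι] {m k W M : ℕ}
    (hd : 1 ≤ numRows m k W) {G₀ : Fin m → ι → ℤ}
    (hM : MinorBound (rowsAndUnits G₀) (numRows m k W) M) (w : ℕ) (hw : w ≤ W) :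
    ∃ S : Finset (Fin (numRows m k w) → ι → ℤ), reachable k G₀ w ⊆ S ∧
      S.card ≤ (((2 * numRows m k W) ^ (k * W) * M * (4 * numRows m k W) ^ numRows m k W *
        (Fintype.card ι + 1) ^ numRows m k W) ^ k) ^ w := by
  classical
  set d := numRows m k W with hdd
  set B := (2 * d) ^ (k * W) * M * (4 * d) ^ d * (Fintype.card ι + 1) ^ d with hB
  induction w with
  | zero => exact ⟨{G₀}, fun G hG => mem_coe.2 (mem_singleton.2 hG), (card_singleton G₀).le⟩
  | succ w ih =>
    obtain ⟨S, hS, hSc⟩ := ih (Nat.le_of_succ_le hw)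
    have hfin : ∀ G ∈ reachable k G₀ w, (floorCombos G).Finite ∧ (floorCombos G).ncard ≤ B := by
      intro G hG
      have hwd : numRows m k w ≤ d := numRows_mono (Nat.le_of_succ_le hw)
      refine finite_floorCombos (by simpa using hwd)
        ((minorBound_of_mem_reachable hd hM w hwd G hG).of_le (Nat.mul_le_mul_right _ ?_))
      exact Nat.pow_le_pow_right (by omega)
        (Nat.mul_le_mul_left _ (Nat.le_of_succ_le hw))
    set T : (Fin (numRows m k w) → ι → ℤ) → Finset (ι → ℤ) := fun G =>
      if h : (floorCombos G).Finite then h.toFinset else ∅ with hT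
    have hTm : ∀ G ∈ reachable k G₀ w, ∀ h ∈ floorCombos G, h ∈ T G := by
      intro G hG h hh
      simp [hT, (hfin G hG).1, hh]
    have hTc : ∀ G ∈ reachable k G₀ w, (T G).card ≤ B := by
      intro G hG
      have h1 := (hfin G hG).2
      rw [Set.ncard_eq_toFinset_card _ (hfin G hG).1] at h1
      simpa [hT, (hfin G hG).1] using h1
    refine ⟨(S.filter (· ∈ reachable k G₀ w)).biUnion fun G =>
      (Fintype.piFinset fun _ : Fin k => T G).image (Fin.append G), ?_, ?_⟩
    · rintro H ⟨G, hG, h, hh, rfl⟩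
      exact mem_coe.2 (mem_biUnion.2 ⟨G, mem_filter.2 ⟨mem_coe.1 (hS hG), hG⟩,
        mem_image_of_mem _ (Fintype.mem_piFinset.2 fun l => hTm G hG _ (hh l))⟩)
    · rw [pow_succ]
      refine (card_biUnion_le_card_mul _ _ (B ^ k) fun G hG => ?_).trans
        (Nat.mul_le_mul_right _ ((card_filter_le _ _).trans hSc))
      refine card_image_le.trans ?_
      rw [Fintype.card_piFinset_const]
      exact Nat.pow_le_pow_left (hTc G (mem_filter.1 hG).2) _

/-! ### Several IPs as one integer matrix -/

/-- The constraint data of `N` IPs side by side in one matrix. -/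
def stack {N p n : ℕ} (y : Fin N → IP p n) : Fin p → Fin N × Option (Fin n) → ℤ :=
  fun i q => q.2.elim ((y q.1).b i) (fun j => (y q.1).A i j)

theorem eq_of_stack_eq {N p n : ℕ} {y y' : Fin N → IP p n} (h : stack y = stack y')
    (hc : ∀ s, (y s).c = (y' s).c) : y = y' := by
  funext s
  have hb : (y s).b = (y' s).b := funext fun i => congrFun (congrFun h i) (s, none)
  have hA : (y s).A = (y' s).A :=
    Matrix.ext fun i j => congrFun (congrFun h i) (s, some j)
  have hcs := hc s
  cases hy : y s
  cases hy' : y' s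
  rw [hy, hy'] at hb hA hcs
  simp_all

theorem stack_addCuts {N p n k : ℕ} (y : Fin N → IP p n) (u : Fin k → Fin p → ℝ) :
    stack (fun s => (y s).addCuts u) =
      Fin.append (stack y) (fun l q => ⌊∑ i, u l i * (stack y i q : ℝ)⌋) := by
  funext i q
  obtain ⟨s, o⟩ := q
  refine Fin.addCases (fun i => ?_) (fun l => ?_) i <;> cases o <;>
    simp [stack, IP.addCuts, IP.cgRow, IP.cgRhs]

theorem applyWaves_c {m n k : ℕ} (I : IP m n) :
    ∀ (W : ℕ) (U : WaveParams m k W), (I.applyWaves W U).c = I.c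
  | 0, _ => rfl
  | W + 1, U => applyWaves_c I W fun w => U w.castSucc

theorem stack_applyWaves_mem {N m n k : ℕ} (y : Fin N → IP m n) :
    ∀ (W : ℕ) (U : WaveParams m k W), (∀ w l i, U w l i ∈ Set.Icc (0 : ℝ) 1) →
      stack (fun s => (y s).applyWaves W U) ∈ reachable k (stack y) W
  | 0, _, _ => rfl
  | W + 1, U, hU => by
    refine ⟨_, stack_applyWaves_mem y W (fun w => U w.castSucc)
      fun w => hU w.castSucc, _, ?_,
      stack_addCuts _ (U (Fin.last W))⟩
    exact fun l => ⟨U (Fin.last W) l, fun i => hU (Fin.last W) l i, rfl⟩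

/-- Cuts leave the objective unchanged, so the stacked matrix determines all `N` resulting IPs,
hence all `N` tree sizes and the pattern `σ`. -/
theorem two_pow_le_card {m n k W κ N : ℕ} {P : Policy (numRows m k W) n} {α β : ℝ}
    {y : Fin N → BoundedIP m n α β} {r : Fin N → ℝ}
    (hy : ∀ σ : Fin N → Bool, ∃ f ∈ treeSizeClass (m := m) (k := k) (W := W) κ P α β,
      ∀ i, r i ≤ f (y i) ↔ σ i = true)
    {S : Finset (Fin (numRows m k W) → Fin N × Option (Fin n) → ℤ)}
    (hS : reachable k (stack fun s => (y s).1) W ⊆ S) : 2 ^ N ≤ S.card := by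
  choose f hf hfσ using hy
  choose U hU hfU using hf
  have hinj : Function.Injective fun σ => stack fun s => (y s).1.applyWaves W (U σ) := by
    intro σ σ' h
    have h1 := eq_of_stack_eq h fun s => by rw [applyWaves_c, applyWaves_c]
    funext i
    have h2 : f σ (y i) = f σ' (y i) := by
      rw [hfU σ, hfU σ']
      simp only
      rw [congrFun h1 i]
    rw [Bool.eq_iff_iff, ← hfσ, ← hfσ, h2]
  calc 2 ^ N = (univ : Finset (Fin N → Bool)).card := by simp
    _ = _ := (card_image_of_injective _ hinj).symm
    _ ≤ S.card := by
      refine card_le_card fun G hG => ?_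
      obtain ⟨σ, -, rfl⟩ := mem_image.1 hG
      exact mem_coe.1 (hS (stack_applyWaves_mem _ W (U σ) (hU σ)))

theorem abs_stack_le {N m n : ℕ} {α β : ℝ} (hα : 0 ≤ α) (hβ : 0 ≤ β)
    (y : Fin N → BoundedIP m n α β) (i : Fin m) (q : Fin N × Option (Fin n)) :
    |stack (fun s => (y s).1) i q| ≤ (⌊α + β⌋₊ : ℤ) := by
  obtain ⟨s, o⟩ := q
  have h1 := (y s).2.1
  have h2 := (y s).2.2
  rw [IP.normA] at h1
  rw [IP.normb] at h2
  have key : ((|stack (fun s => (y s).1) i (s, o)| : ℤ) : ℝ) ≤ α + β := by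
    push_cast
    cases o with
    | none =>
      have := single_le_sum (f := fun i => |((y s).1.b i : ℝ)|) (fun _ _ => abs_nonneg _)
        (mem_univ i)
      simp only [stack, Option.elim_none] at *
      linarith
    | some j =>
      have h3 := single_le_sum (f := fun j => |((y s).1.A i j : ℝ)|) (fun _ _ => abs_nonneg _)
        (mem_univ j)
      have h4 := single_le_sum (f := fun i => ∑ j, |((y s).1.A i j : ℝ)|)
        (fun _ _ => sum_nonneg fun _ _ => abs_nonneg _) (mem_univ i)
      simp only [stack, Option.elim_some] at *
      linarith
  rw [← Int.natCast_natAbs] at key ⊢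
  rw [Int.cast_natCast] at key
  exact_mod_cast Nat.le_floor key

theorem reachable_zero {ι : Type*} {m k : ℕ} :
    ∀ w, reachable k (0 : Fin m → ι → ℤ) w ⊆ {0}
  | 0 => subset_rfl
  | w + 1 => by
    rintro H ⟨G, hG, h, hh, rfl⟩
    obtain rfl : G = 0 := reachable_zero w hG
    change Fin.append (0 : Fin (numRows m k w) → ι → ℤ) h = 0
    funext i
    refine Fin.addCases (fun i => ?_) (fun l => ?_) i
    · simp
    · obtain ⟨u, -, hu⟩ := hh l
      rw [Fin.append_right, hu]
      funext j
      simp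

/-! ### The bound on the pseudo-dimension -/

theorem two_pow_le_of_pseudoShatters {m n k W κ N : ℕ} {P : Policy (numRows m k W) n} {α β : ℝ}
    (hm : 1 ≤ m) (hα : 0 ≤ α) (hβ : 0 ≤ β) (hαβ : 1 ≤ α + β)
    (hN : PseudoShatters (treeSizeClass (m := m) (k := k) (W := W) κ P α β) N) :
    2 ^ N ≤ (8 * (m + k * W) ^ 3 * ⌊α + β⌋₊ * (N * (n + 1) + 1)) ^ ((m + k * W) * (k * W)) := by
  obtain ⟨y, r, hy⟩ := hN
  have ha : 1 ≤ ⌊α + β⌋₊ := Nat.one_le_floor_iff _ |>.2 hαβ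
  set a := ⌊α + β⌋₊
  have hd : 1 ≤ numRows m k W := by rw [numRows_eq]; omega
  obtain ⟨S, hS, hSc⟩ := exists_finset_reachable (W := W) hd
    (minorBound_of_entries_le hd ha (abs_stack_le hα hβ y)) W le_rfl
  refine (two_pow_le_card hy hS).trans (hSc.trans ?_)
  rw [numRows_eq] at hd ⊢
  set d := m + k * W
  have hc : Fintype.card (Fin N × Option (Fin n)) = N * (n + 1) := by simp
  rw [hc, ← pow_mul, pow_mul _ d]
  refine Nat.pow_le_pow_left ?_ _
  calc (2 * d) ^ (k * W) * (d * a) ^ d * (4 * d) ^ d * (N * (n + 1) + 1) ^ d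
      ≤ (2 * d) ^ d * (d * a) ^ d * (4 * d) ^ d * (N * (n + 1) + 1) ^ d := by
        gcongr
        · omega
        · omega
    _ = (8 * d ^ 3 * a * (N * (n + 1) + 1)) ^ d := by
        rw [← mul_pow, ← mul_pow, ← mul_pow]
        congr 1
        ring

/-- Removes `N` from the logarithm: `log t ≤ t - 1` at `t = N / (8 p)`, where the weight `8 p` turns
the linear term into `N / 4`, less than `N log 2`. -/
theorem le_of_two_pow_le {N p x : ℝ} (hp : 1 ≤ p) (hx : 2 ≤ x) (hpx : p ≤ x ^ 2) (hN : 0 < N)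
    (h : N * Real.log 2 ≤ 2 * p * Real.log (x ^ 13 * N)) : N ≤ 100 * (p * Real.log x) := by
  have hx0 : 0 < x := by linarith
  have hl2 := Real.log_two_gt_d9
  have hlx : Real.log 2 ≤ Real.log x := Real.log_le_log (by norm_num) hx
  have h1 : Real.log (x ^ 13 * N) = 13 * Real.log x + Real.log N := by
    rw [Real.log_mul (by positivity) hN.ne', Real.log_pow]
    norm_num
  have h2 : Real.log N ≤ N / (8 * p) + 5 * Real.log x := by
    have h3 : Real.log N = Real.log (N / (8 * p)) + Real.log (8 * p) := by
      rw [← Real.log_mul (by positivity) (by positivity)]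
      congr 1
      field_simp
    have h4 : Real.log (N / (8 * p)) ≤ N / (8 * p) :=
      (Real.log_le_sub_one_of_pos (by positivity)).trans (by linarith)
    have h5 : Real.log (8 * p) ≤ 5 * Real.log x := by
      calc Real.log (8 * p) ≤ Real.log (x ^ 5) := by
            refine Real.log_le_log (by positivity) ?_
            calc 8 * p ≤ x ^ 3 * x ^ 2 := by
                  refine mul_le_mul ?_ hpx (by linarith) (by positivity)
                  calc (8 : ℝ) = 2 ^ 3 := by norm_num
                    _ ≤ x ^ 3 := by gcongr
              _ = x ^ 5 := by ring
        _ = 5 * Real.log x := by rw [Real.log_pow]; norm_num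
    linarith
  rw [h1] at h
  have h3 : 2 * p * (13 * Real.log x + Real.log N) ≤ 36 * (p * Real.log x) + N / 4 := by
    calc 2 * p * (13 * Real.log x + Real.log N)
        ≤ 2 * p * (13 * Real.log x + (N / (8 * p) + 5 * Real.log x)) := by gcongr
      _ = 36 * (p * Real.log x) + N / 4 := by field_simp; ring
  -- Here `log 2 - 1/4 > 0.44` and `36 / 0.44 < 100`.
  nlinarith

theorem natCast_le_of_pseudoShatters {m n k W κ N : ℕ} {P : Policy (numRows m k W) n} {α β : ℝ}
    (hn : 1 ≤ n) (hm : 1 ≤ m) (hk : 1 ≤ k) (hW : 1 ≤ W) (hα : 0 ≤ α) (hβ : 0 ≤ β)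
    (hN : PseudoShatters (treeSizeClass (m := m) (k := k) (W := W) κ P α β) N) :
    (N : ℝ) ≤ 100 * ((m : ℝ) * (k : ℝ) ^ 2 * (W : ℝ) ^ 2 *
      Real.log ((m : ℝ) * (k : ℝ) * (W : ℝ) * (α + β + (n : ℝ)))) := by
  have hn' : (1 : ℝ) ≤ n := by exact_mod_cast hn
  have hm' : (1 : ℝ) ≤ m := by exact_mod_cast hm
  have hk' : (1 : ℝ) ≤ k := by exact_mod_cast hk
  have hW' : (1 : ℝ) ≤ W := by exact_mod_cast hW
  have hkW : (1 : ℝ) ≤ k * W := one_le_mul_of_one_le_of_one_le hk' hW'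
  have hmk : (1 : ℝ) ≤ m * k * W := by
    rw [mul_assoc]; exact one_le_mul_of_one_le_of_one_le hm' hkW
  set x : ℝ := (m : ℝ) * k * W * (α + β + n) with hx
  rcases Nat.eq_zero_or_pos N with rfl | hNpos
  · have : 0 ≤ Real.log x :=
      Real.log_nonneg (one_le_mul_of_one_le_of_one_le hmk (by linarith))
    rw [Nat.cast_zero]
    positivity
  have hNpos' : (1 : ℝ) ≤ N := by exact_mod_cast hNpos
  rcases lt_or_ge (α + β) 1 with hlt | hαβ
  -- For `α + β < 1` all integer data vanish and so do all cuts; only one matrix is reachable. This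
  -- case is separate because the logarithm in the bound can be 0, whereas `α + β ≥ 1` ensures `x ≥
  -- 2`.
  · obtain ⟨y, r, hy⟩ := hN
    have h0 : (stack fun s => (y s).1) = 0 := by
      funext i q
      have := abs_stack_le hα hβ y i q
      rw [Nat.floor_eq_zero.2 hlt] at this
      simpa using this
    have h1 := two_pow_le_card hy (S := {0}) (by
      rw [h0, coe_singleton]; exact reachable_zero W)
    rw [card_singleton] at h1
    have := Nat.one_lt_two_pow hNpos.ne'
    omega
  have h := two_pow_le_of_pseudoShatters hm hα hβ hαβ hN
  have h' : (2 : ℝ) ^ N ≤ (8 * ((m : ℝ) + k * W) ^ 3 * ⌊α + β⌋₊ * (N * (n + 1) + 1)) ^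
      ((m + k * W) * (k * W)) := by exact_mod_cast h
  have hfl : (⌊α + β⌋₊ : ℝ) ≤ α + β := Nat.floor_le (by linarith)
  have hyx : (m : ℝ) * k * W ≤ x := le_mul_of_one_le_right (by linarith) (by linarith)
  have hdx : (m : ℝ) + k * W ≤ 2 * x := by
    have h1 : (m : ℝ) ≤ m * k * W := by
      rw [mul_assoc]; exact le_mul_of_one_le_right (by linarith) hkW
    have h2 : (k : ℝ) * W ≤ m * k * W := by
      rw [mul_assoc]; exact le_mul_of_one_le_left (by linarith) hm'
    linarith
  have hsx : α + β + n ≤ x := le_mul_of_one_le_left (by linarith) hmk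
  have hx2 : 2 ≤ x := by linarith
  -- Every factor is at most a constant times a power of `x`, times `N`; since `x ≥ 2`, the constant
  -- 192 is absorbed by `x ^ 8`.
  have hbase : 8 * ((m : ℝ) + k * W) ^ 3 * ⌊α + β⌋₊ * (N * (n + 1) + 1) ≤ x ^ 13 * N := by
    have h1 : (N : ℝ) * (n + 1) + 1 ≤ 3 * (N * x) := by
      have := mul_le_mul_of_nonneg_left (by linarith : (n : ℝ) + 2 ≤ 3 * x) (Nat.cast_nonneg N)
      linarith
    calc 8 * ((m : ℝ) + k * W) ^ 3 * ⌊α + β⌋₊ * (N * (n + 1) + 1)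
        ≤ 8 * (2 * x) ^ 3 * x * (3 * (N * x)) := by
          gcongr
          linarith
      _ = 192 * (x ^ 5 * N) := by ring
      _ ≤ x ^ 8 * (x ^ 5 * N) := by
          gcongr
          calc (192 : ℝ) ≤ 2 ^ 8 := by norm_num
            _ ≤ x ^ 8 := by gcongr
      _ = x ^ 13 * N := by ring
  have hxN : 1 ≤ x ^ 13 * N :=
    one_le_mul_of_one_le_of_one_le (one_le_pow₀ (by linarith)) hNpos'
  refine le_of_two_pow_le (p := (m : ℝ) * (k : ℝ) ^ 2 * (W : ℝ) ^ 2) ?_ hx2 ?_ (by linarith) ?_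
  · exact one_le_mul_of_one_le_of_one_le
      (one_le_mul_of_one_le_of_one_le hm' (one_le_pow₀ hk')) (one_le_pow₀ hW')
  · calc (m : ℝ) * (k : ℝ) ^ 2 * (W : ℝ) ^ 2 = (m : ℝ) * ((k : ℝ) * W) ^ 2 := by ring
      _ ≤ (m : ℝ) ^ 2 * ((k : ℝ) * W) ^ 2 := by
          gcongr
          exact le_self_pow₀ hm' two_ne_zero
      _ = ((m : ℝ) * k * W) ^ 2 := by ring
      _ ≤ x ^ 2 := by gcongr
  · have h2 := Real.log_le_log (by positivity) (h'.trans
      (pow_le_pow_left₀ (by positivity) hbase _))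
    rw [Real.log_pow, Real.log_pow] at h2
    refine h2.trans (mul_le_mul_of_nonneg_right ?_ (Real.log_nonneg hxN))
    push_cast
    have h3 : (m : ℝ) + k * W ≤ 2 * (m * (k * W)) := by
      have := mul_nonneg (sub_nonneg.2 hm') (sub_nonneg.2 hkW)
      linarith [one_le_mul_of_one_le_of_one_le hm' hkW]
    calc ((m : ℝ) + k * W) * (k * W) ≤ 2 * (m * (k * W)) * (k * W) := by gcongr
      _ = _ := by ring

end BranchCut

/-- The implied constant `C` is absolute: it depends neither on the dimensions, the number and size
of the waves, the norm bounds, the tree-size cap `κ`, nor on the fixed policies of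
branch-and-cut. -/
theorem theorem5 :
    ∃ C : ℝ, 0 < C ∧
      ∀ (n m k W : ℕ), 1 ≤ n → 1 ≤ m → 1 ≤ k → 1 ≤ W →
      ∀ (α β : ℝ), 0 ≤ α → 0 ≤ β →
      ∀ (κ : ℕ) (P : BranchCut.Policy (BranchCut.numRows m k W) n),
      ∃ d : ℕ,
        BranchCut.pdim (BranchCut.treeSizeClass (m := m) (k := k) (W := W) κ P α β) = (d : ℕ∞) ∧
        (d : ℝ) ≤ C * ((m : ℝ) * (k : ℝ) ^ 2 * (W : ℝ) ^ 2 *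
          Real.log ((m : ℝ) * (k : ℝ) * (W : ℝ) * (α + β + (n : ℝ)))) := by
  refine ⟨100, by norm_num, fun n m k W hn hm hk hW α β hα hβ κ P => ?_⟩
  set R : ℝ := 100 * ((m : ℝ) * (k : ℝ) ^ 2 * (W : ℝ) ^ 2 *
    Real.log ((m : ℝ) * (k : ℝ) * (W : ℝ) * (α + β + (n : ℝ)))) with hR
  have hR0 : 0 ≤ R := by
    have hmkW : (1 : ℝ) ≤ (m : ℝ) * k * W := by
      exact_mod_cast Nat.mul_pos (Nat.mul_pos hm hk) hW
    have hn' : (1 : ℝ) ≤ n := by exact_mod_cast hn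
    have : 0 ≤ Real.log ((m : ℝ) * (k : ℝ) * (W : ℝ) * (α + β + (n : ℝ))) :=
      Real.log_nonneg (one_le_mul_of_one_le_of_one_le hmkW (by linarith))
    positivity
  have hle : BranchCut.pdim (BranchCut.treeSizeClass (m := m) (k := k) (W := W) κ P α β) ≤
      (⌊R⌋₊ : ℕ∞) := by
    refine iSup₂_le fun N hN => ?_
    exact Nat.cast_le.2 (Nat.le_floor
      (BranchCut.natCast_le_of_pseudoShatters hn hm hk hW hα hβ hN))
  obtain ⟨d, hd, hdR⟩ := ENat.le_natCast_iff.1 hle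
  exact ⟨d, hd, (Nat.cast_le.2 hdR).trans (Nat.floor_le hR0)⟩
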